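/- **Theorem 4.6.** The language of relation algebras has the constants $0, 1, 1'$, the unary operations $-, \smile$ and the binary operations $+, ;$ (and equality). A *relation algebra* is a structure $(A,0,1,+,-,1',\smile,;)$ such that $(A,0,1,+,-)$ is a Boolean algebra, $(A,1',\smile,;)$ is a monoid with involution ($a^{\smile\smile}=a$, $(a;b)^\smile=b^\smile;a^\smile$), $\smile$ and $;$ preserve $0$ and $+$ in each argument, and $a^\smile;(-(a;b))\le -b$ for all $a,b$. For an equivalence relation $E$ on a set $X$, the *proper relation algebra* $\mathcal P(E)$ consists of all subsets of $E$, with $0=\emptyset$, $1=E$, union, complement relative to $E$, $1'=\{(x,x):x\in X\}$, converse, and composition of relations. A relation algebra is *representable* if it embeds into some $\mathcal P(E)$; RRA is the class of representable relation algebras. The *quantifier depth* of a first-order formula is the maximal number of nested quantifiers in it. (1) Let $\Sigma$ be a set of first-order sentences in the language of relation algebras that defines RRA, in the sense that a relation algebra is a model of $\Sigma$ if and only if it is representable. (In particular, this holds if RRA is the class of all models of $\Sigma$.) Then for every $n$ there is a sentence in $\Sigma$ of quantifier depth at least $n$. (2) For sets $P, Q$ let $\mathcal B_{P,Q}$ be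 the algebra whose elements are all sets of *atoms* $$1',\ \mathbf b,\ \mathbf w,\ \mathbf y,\quad \mathbf g_i\ (i\in P),\quad \mathbf r_{j,j'}\ (j,j'\in Q),$$ with the Boolean operations of sets, identity $\{1'\}$, converse acting elementwise by $\mathbf r_{j,j'}^\smile=\mathbf r_{j',j}$ and $a^\smile=a$ for all other atoms, and $X;Y$ the set of atoms $c$ such that $(a,b,c)$ is not forbidden for some $a\in X$, $b\in Y$. Here a triple is *forbidden* if one of its Peircean transforms $$(a,b,c),\ (a^\smile,c,b),\ (c,b^\smile,a),\ (b,c^\smile,a^\smile),\ (c^\smile,a,b^\smile),\ (b^\smile,a^\smile,c^\smile)$$ is one of the following: * $(1',a,b)$ with $a\ne b$; * $(\mathbf g_i,\mathbf g_{i'},\mathbf g_{i''})$ or $(\mathbf g_i,\mathbf g_{i'},\mathbf w)$, for any $i,i',i''\in P$; * $(\mathbf y,\mathbf y,\mathbf y)$ or $(\mathbf y,\mathbf y,\mathbf b)$; * $(\mathbf r_{j_1,j_2},\mathbf r_{j_2',j_3'},\mathbf r_{j_1^*,j_3^*})$ unless $j_1=j_1^*$, $j_2=j_2'$ and $j_3'=j_3^*$;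 * $(\mathbf g_i,\mathbf g_i,\mathbf r_{j,j'})$ or $(\mathbf g_i,\mathbf g_{i'},\mathbf r_{j,j})$, for any $i,i'\in P$, $j,j'\in Q$. Let $n\ge 0$, and let $S,T$ be sets with $|S|=2^{n+1}$ and $|T|=2^{n+1}+1$. Then $\mathcal B_{S,S}$ and $\mathcal B_{T,S}$ are relation algebras, $\mathcal B_{S,S}$ is representable, $\mathcal B_{T,S}$ is not representable, and $\mathcal B_{S,S}$ and $\mathcal B_{T,S}$ satisfy the same first-order sentences of quantifier depth at most $n$ in the language of relation algebras. -/

import Mathlib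

open scoped FirstOrder

universe u v

namespace RelAlg

/-! ### The first-order language of relation algebras -/

/-- The operation symbols `0, 1, 1', -, ˘, +, ;`. -/
inductive Op : ℕ → Type
  | zero : Op 0
  | one : Op 0
  | ident : Op 0
  | neg : Op 1
  | conv : Op 1
  | add : Op 2
  | comp : Op 2

/-- The language of relation algebras: the operation symbols above and equality only. -/
def lang : FirstOrder.Language.{0, 0} where
  Functions := Op
  Relations := fun _ => Empty

/-- The quantifier depth of a formula. (In Mathlib, formulas are built from atomic formulas by
`⊥`, `→` and `∀`; the other connectives and `∃` are abbreviations, so that `∃` also counts as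
one quantifier.) -/
def quantifierDepth {L : FirstOrder.Language.{u, v}} {α : Type*} : ∀ {n : ℕ}, L.BoundedFormula α n → ℕ
  | _, .falsum => 0
  | _, .equal _ _ => 0
  | _, .rel _ _ => 0
  | _, .imp φ ψ => max (quantifierDepth φ) (quantifierDepth ψ)
  | _, .all φ => quantifierDepth φ + 1

/-- The structure for `lang` with the given operations. -/
@[reducible]
def mkStructure {A : Type u} (zero one ident : A) (neg conv : A → A) (add comp : A → A → A) :
    lang.Structure A where
  funMap := fun {_} f x =>
    match f, x with
    | Op.zero, _ => zero
    | Op.one, _ => one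
    | Op.ident, _ => ident
    | Op.neg, x => neg (x 0)
    | Op.conv, x => conv (x 0)
    | Op.add, x => add (x 0) (x 1)
    | Op.comp, x => comp (x 0) (x 1)
  RelMap := fun {_} r _ => Empty.elim r

/-! ### Relation algebras -/

section Operations

variable {A : Type u} [lang.Structure A]

/-- The interpretation of `0`. -/
def zero : A := FirstOrder.Language.Structure.funMap (L := lang) Op.zero ![]

/-- The interpretation of `1`. -/
def one : A := FirstOrder.Language.Structure.funMap (L := lang) Op.one ![]

/-- The interpretation of the identity constant `1'`. -/
def ident : A := FirstOrder.Language.Structure.funMap (L := lang) Op.ident ![]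

/-- The interpretation of `-`. -/
def neg (a : A) : A := FirstOrder.Language.Structure.funMap (L := lang) Op.neg ![a]

/-- The interpretation of the converse operation. -/
def conv (a : A) : A := FirstOrder.Language.Structure.funMap (L := lang) Op.conv ![a]

/-- The interpretation of `+`. -/
def add (a b : A) : A := FirstOrder.Language.Structure.funMap (L := lang) Op.add ![a, b]

/-- The interpretation of the composition `;`. -/
def comp (a b : A) : A := FirstOrder.Language.Structure.funMap (L := lang) Op.comp ![a, b]

end Operations

/-- A structure for the language of relation algebras is a relation algebra. -/
structure IsRelationAlgebra (A : Type u) [lang.Structure A] : Prop where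
  /-- `(A, 0, 1, +, -)` is a Boolean algebra. -/
  boolean : ∃ B : BooleanAlgebra A, B.bot = (zero : A) ∧ B.top = (one : A) ∧
    (∀ a b : A, B.sup a b = add a b) ∧ ∀ a : A, B.compl a = neg a
  /-- `(A, 1', ˘, ;)` is a monoid with involution. -/
  comp_assoc : ∀ a b c : A, comp (comp a b) c = comp a (comp b c)
  ident_comp : ∀ a : A, comp ident a = a
  comp_ident : ∀ a : A, comp a ident = a
  conv_conv : ∀ a : A, conv (conv a) = a
  conv_comp : ∀ a b : A, conv (comp a b) = comp (conv b) (conv a)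
  /-- Converse and composition are normal operators (they preserve `0` and `+` in each
  argument). -/
  conv_zero : conv (zero : A) = zero
  zero_comp : ∀ a : A, comp zero a = zero
  comp_zero : ∀ a : A, comp a zero = zero
  conv_add : ∀ a b : A, conv (add a b) = add (conv a) (conv b)
  add_comp : ∀ a b c : A, comp (add a b) c = add (comp a c) (comp b c)
  comp_add : ∀ a b c : A, comp a (add b c) = add (comp a b) (comp a c)
  /-- The Peircean law `a˘ ; -(a ; b) ≤ -b`, where `x ≤ y` means `x + y = y`. -/
  peirce : ∀ a b : A, add (comp (conv a) (neg (comp a b))) (neg b) = neg b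

/-! ### Proper relation algebras and representability -/

/-- The carrier of the proper relation algebra of an equivalence relation `E` on `X`:
all binary relations contained in `E`. -/
def ProperAlgebra {X : Type u} (E : Setoid X) : Type u :=
  {R : Set (X × X) // ∀ p ∈ R, E.r p.1 p.2}

instance {X : Type u} (E : Setoid X) : lang.Structure (ProperAlgebra E) :=
  mkStructure
    ⟨∅, fun _ h => h.elim⟩
    ⟨{p | E.r p.1 p.2}, fun _ h => h⟩
    ⟨{p | p.1 = p.2}, fun p (h : p.1 = p.2) => h ▸ E.iseqv.refl p.1⟩
    (fun R => ⟨{p | E.r p.1 p.2 ∧ p ∉ R.1}, fun _ h => h.1⟩)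
    (fun R => ⟨{p | (p.2, p.1) ∈ R.1}, fun _ h => E.iseqv.symm (R.2 _ h)⟩)
    (fun R R' => ⟨R.1 ∪ R'.1, fun p h => h.elim (R.2 p) (R'.2 p)⟩)
    (fun R R' => ⟨{p | ∃ z, (p.1, z) ∈ R.1 ∧ (z, p.2) ∈ R'.1},
      fun p ⟨z, h, h'⟩ => E.iseqv.trans (R.2 (p.1, z) h) (R'.2 (z, p.2) h')⟩)

/-- `A` belongs to `RRA`: it is a relation algebra that embeds into a proper relation algebra. -/
def IsRRA (A : Type u) [lang.Structure A] : Prop :=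
  IsRelationAlgebra A ∧ ∃ (X : Type u) (E : Setoid X), Nonempty (A ↪[lang] ProperAlgebra E)

/-- The set `Th` of sentences defines `RRA`: a relation algebra is a model of `Th` if and only if
it is representable. -/
def DefinesRRA (Th : lang.Theory) : Prop :=
  ∀ (A : Type u) [lang.Structure A], IsRelationAlgebra A → (A ⊨ Th ↔ IsRRA A)

/-! ### The rainbow algebras -/

/-- The atoms `1', b, w, y, g_i (i ∈ S), r_{j,j'} (j, j' ∈ T)`. -/
inductive Atom (S T : Type u) : Type u
  | ident : Atom S T
  | black : Atom S T
  | white : Atom S T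
  | yellow : Atom S T
  | green (i : S) : Atom S T
  | red (j j' : T) : Atom S T

namespace Atom

variable {S T : Type u}

/-- The converse of an atom: all atoms are self-converse, except that `r_{j,j'}˘ = r_{j',j}`. -/
def conv : Atom S T → Atom S T
  | red j j' => red j' j
  | a => a

/-- The forbidden triples, up to Peircean transforms. -/
inductive BasicForbidden : Atom S T → Atom S T → Atom S T → Prop
  | ident (a b : Atom S T) : a ≠ b → BasicForbidden ident a b
  | ggg (i i' i'' : S) : BasicForbidden (green i) (green i') (green i'')
  | ggw (i i' : S) : BasicForbidden (green i) (green i') white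
  | yyy : BasicForbidden yellow yellow yellow
  | yyb : BasicForbidden yellow yellow black
  | rrr (j₁ j₂ j₂' j₃' k₁ k₃ : T) : ¬ (j₁ = k₁ ∧ j₂ = j₂' ∧ j₃' = k₃) →
      BasicForbidden (red j₁ j₂) (red j₂' j₃') (red k₁ k₃)
  | ggr_same (i : S) (j j' : T) : BasicForbidden (green i) (green i) (red j j')
  | ggr_diag (i i' : S) (j : T) : BasicForbidden (green i) (green i') (red j j)

/-- The triple `(a, b, c)` is forbidden if one of its six Peircean transforms is in the list. -/
def Forbidden (a b c : Atom S T) : Prop :=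
  BasicForbidden a b c ∨ BasicForbidden a.conv c b ∨ BasicForbidden c b.conv a ∨
    BasicForbidden b c.conv a.conv ∨ BasicForbidden c.conv a b.conv ∨
    BasicForbidden b.conv a.conv c.conv

end Atom

/-- The carrier of the rainbow algebra `B_{S,T}`: all sets of atoms. -/
def Rainbow (S T : Type u) : Type u := Set (Atom S T)

/-- `B_{S,T}` is the complex algebra of the rainbow atom structure: the Boolean operations are
those of sets, and `X ; Y` consists of the atoms `c` such that `(a, b, c)` is not forbidden for
some `a ∈ X` and `b ∈ Y`. -/
instance (S T : Type u) : lang.Structure (Rainbow S T) :=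
  mkStructure (A := Set (Atom S T))
    ∅
    Set.univ
    {Atom.ident}
    (fun X => Xᶜ)
    (fun X => Atom.conv '' X)
    (fun X Y => X ∪ Y)
    (fun X Y => {c | ∃ a ∈ X, ∃ b ∈ Y, ¬ Atom.Forbidden a b c})

end RelAlg

/-! For finite `P` and `Q` with at least two elements in `Q`, the rainbow algebra is representable
exactly when |P| ≤ |Q|, while a sentence of depth at most n counts green atoms only up to 2^(n+1).

In a representation, a black edge (x, y) has for every i a point z_i joined to x by green i and to y
by yellow. An edge between distinct z_i is compatible with two greens and with two yellows, so it is
red, and a red clique is indexed injectively by `Q` (`exists_red_indexing`). Hence `P` injects into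
`Q`.

Conversely, a representation is built by adding points to finite labelled graphs. White is excluded
only by two greens and black only by two yellows, so the sole critical demand is a point with one
green and one yellow edge. Its edges to the existing points of the same cone must be red; as its
green index is new there and |P| ≤ |Q|, some red index is still free (`exists_cone_indexing`,
`exists_witness`).

Indistinguishability is an Ehrenfeucht–Fraïssé argument. Green indices are coloured by the chosen
elements that contain them. A new element splits each colour class in two, and can be answered so
that class sizes agree up to half the former threshold (`SameFibers.exists_set`). After n moves the
threshold is 2, which suffices for composition because a consistent triple has at most two greens
(`OneExtending.exists_consistent`). So sentences of depth below n cannot separate the two algebras,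
and cannot define RRA. -/

namespace RelAlg
-- Consistent triples of atoms.
namespace Atom

variable {P Q : Type u}

/-- The basic forbidden triples, by pattern matching. -/
def BasicPattern : Atom P Q → Atom P Q → Atom P Q → Prop
  | ident, a, b => a ≠ b
  | green _, green _, green _ => True
  | green _, green _, white => True
  | green i, green i', red j j' => i = i' ∨ j = j'
  | yellow, yellow, yellow => True
  | yellow, yellow, black => True
  | red j₁ j₂, red j₂' j₃, red k₁ k₃ => ¬ (j₁ = k₁ ∧ j₂ = j₂' ∧ j₃ = k₃)
  | _, _, _ => False

/-- The pattern form is decided by `simp` on constructors, which turns statements about specific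
atoms into finite case checks. -/
theorem basicForbidden_iff {a b c : Atom P Q} : BasicForbidden a b c ↔ BasicPattern a b c := by
  constructor
  · rintro (_ | _ | _ | _ | _ | _ | _ | _) <;> simp_all [BasicPattern]
  · intro h
    unfold BasicPattern at h
    split at h
    · exact .ident _ _ h
    · exact .ggg _ _ _
    · exact .ggw _ _
    · rcases h with rfl | rfl
      · exact .ggr_same _ _ _
      · exact .ggr_diag _ _ _
    · exact .yyy
    · exact .yyb
    · exact .rrr _ _ _ _ _ _ h
    · exact h.elim

@[simp]
theorem conv_conv (a : Atom P Q) : a.conv.conv = a := by cases a <;> rfl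

theorem conv_injective : Function.Injective (conv : Atom P Q → Atom P Q) :=
  Function.LeftInverse.injective conv_conv

@[simp]
theorem conv_eq_ident {a : Atom P Q} : a.conv = ident ↔ a = ident := by
  cases a <;> simp [conv]

/-- A triple of atoms is consistent if it is not forbidden. -/
def Consistent (a b c : Atom P Q) : Prop := ¬ Forbidden a b c

/-- The six Peircean transforms form a group, so applying one of them only permutes the disjuncts of
`Forbidden`. -/
theorem consistent_conv_left {a b c : Atom P Q} : Consistent a.conv c b ↔ Consistent a b c := by
  simp only [Consistent, Forbidden, conv_conv]; tauto

theorem consistent_conv_mid {a b c : Atom P Q} : Consistent c b.conv a ↔ Consistent a b c := by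
  simp only [Consistent, Forbidden, conv_conv]; tauto

theorem consistent_conv_all {a b c : Atom P Q} :
    Consistent b.conv a.conv c.conv ↔ Consistent a b c := by
  simp only [Consistent, Forbidden, conv_conv]; tauto

@[simp]
theorem consistent_ident_left {a b : Atom P Q} : Consistent ident a b ↔ a = b := by
  constructor
  · intro h
    by_contra hne
    exact h (.inl (.ident _ _ hne))
  · rintro rfl
    cases a <;> simp [Consistent, Forbidden, conv, basicForbidden_iff, BasicPattern]

@[simp]
theorem consistent_ident_mid {a b : Atom P Q} : Consistent a ident b ↔ a = b := by
  rw [← consistent_conv_all]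
  exact consistent_ident_left.trans conv_injective.eq_iff

@[simp]
theorem consistent_ident_right {a b : Atom P Q} : Consistent a b ident ↔ b = a.conv := by
  rw [← consistent_conv_left, consistent_ident_mid, eq_comm]

/-- An atom is green. -/
def IsGreen (a : Atom P Q) : Prop := ∃ i, a = green i

/-- White and, dually, black are the default labels of all later constructions: each has a single
obstruction besides the identity. -/
theorem consistent_white {a b : Atom P Q} (ha : a ≠ ident) (hb : b ≠ ident)
    (h : ¬ (a.IsGreen ∧ b.IsGreen)) : Consistent a b white := by
  cases a <;> cases b <;>
    simp_all [Consistent, Forbidden, conv, basicForbidden_iff, BasicPattern, IsGreen]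

theorem consistent_black {a b : Atom P Q} (ha : a ≠ ident) (hb : b ≠ ident)
    (h : ¬ (a = yellow ∧ b = yellow)) : Consistent a b black := by
  cases a <;> cases b <;>
    simp_all [Consistent, Forbidden, conv, basicForbidden_iff, BasicPattern]

theorem consistent_yellow_yellow_red (j j' : Q) :
    Consistent (yellow : Atom P Q) yellow (red j j') := by
  simp [Consistent, Forbidden, conv, basicForbidden_iff, BasicPattern]

theorem consistent_green_green_red {i i' : P} {j j' : Q} :
    Consistent (green i) (green i') (red j j') ↔ i ≠ i' ∧ j ≠ j' := by
  simp [Consistent, Forbidden, conv, basicForbidden_iff, BasicPattern]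
  tauto

theorem consistent_red_red_red {j₁ j₂ j₂' j₃ k₁ k₃ : Q} :
    Consistent (red j₁ j₂ : Atom P Q) (red j₂' j₃) (red k₁ k₃) ↔
      j₁ = k₁ ∧ j₂ = j₂' ∧ j₃ = k₃ := by
  simp [Consistent, Forbidden, conv, basicForbidden_iff, BasicPattern]
  tauto

/-- An atom compatible with two green edges and with two yellow edges is the identity or red. -/
theorem eq_ident_or_red {i i' : P} {c : Atom P Q} (hg : Consistent (green i) (green i') c)
    (hy : Consistent yellow yellow c) :
    (c = ident ∧ i = i') ∨ ∃ j j', c = red j j' ∧ i ≠ i' ∧ j ≠ j' := by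
  cases c with
  | red j j' => exact .inr ⟨j, j', rfl, consistent_green_green_red.1 hg⟩
  | ident =>
    simp [conv] at hg
    exact .inl ⟨rfl, hg.symm⟩
  | _ => simp [Consistent, Forbidden, conv, basicForbidden_iff, BasicPattern] at hg hy

/-- In a clique of red edges the indices come from an indexing of the vertices. -/
theorem exists_red_indexing [Nonempty Q] {W : Type*} (l : W → W → Atom P Q)
    (hconv : ∀ w w', l w' w = (l w w').conv)
    (htri : ∀ w₁ w₂ w₃, Consistent (l w₁ w₂) (l w₂ w₃) (l w₁ w₃))
    (hred : ∀ w w', w ≠ w' → ∃ j j', l w w' = red j j' ∧ j ≠ j') :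
    ∃ ρ : W → Q, Function.Injective ρ ∧ ∀ w w', w ≠ w' → l w w' = red (ρ w) (ρ w') := by
  classical
  -- Injectivity is automatic, since the two indices on each edge differ.
  suffices ∃ ρ : W → Q, ∀ w w', w ≠ w' → l w w' = red (ρ w) (ρ w') by
    obtain ⟨ρ, hρ⟩ := this
    refine ⟨ρ, fun w w' hww => ?_, hρ⟩
    by_contra hne
    obtain ⟨j, j', h, hj⟩ := hred w w' hne
    rw [hρ w w' hne, hww] at h
    injection h with h₁ h₂
    exact hj (h₁ ▸ h₂)
  rcases subsingleton_or_nontrivial W with hW | ⟨w₀, w₁, hne⟩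
  · exact ⟨fun _ => Classical.arbitrary Q, fun w w' h => (h (Subsingleton.elim _ _)).elim⟩
  choose! p q hpq hne' using hred
  -- Indices are read off the edges leaving `w₀`: the triangles `w₀ w₁ w` show that the first index
  -- on these edges is constant, and it becomes the index of `w₀`.
  refine ⟨fun w => if w = w₀ then p w₀ w₁ else q w₀ w, ?_⟩
  have h₀ : ∀ w, w ≠ w₀ → l w₀ w = red (p w₀ w₁) (q w₀ w) := by
    intro w hw
    rcases eq_or_ne w w₁ with rfl | hw'
    · exact hpq _ _ hne
    have := htri w₀ w₁ w
    rw [hpq _ _ hne, hpq _ _ hw'.symm, hpq _ _ hw.symm, consistent_red_red_red] at this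
    rw [hpq _ _ hw.symm, this.1]
  intro w w' hww
  by_cases hw : w = w₀
  · subst hw
    simp [hww.symm, h₀ w' hww.symm]
  by_cases hw' : w' = w₀
  · subst hw'
    rw [hconv w' w, h₀ w hww]
    simp [hww, conv]
  have := htri w₀ w w'
  rw [h₀ w hw, h₀ w' hw', hpq _ _ hww, consistent_red_red_red] at this
  simp [hw, hw', hpq _ _ hww, this.2.1, this.2.2]

end Atom
open Atom

/-! ### The relation algebra axioms. -/

namespace Atom
variable {P Q : Type u}

/-- Against two different greens the common third side has to be red with distinct indices; hence
`Nontrivial Q`. -/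
theorem exists_consistent_yellow [Nontrivial Q] {r s : Atom P Q} (hr : r ≠ ident)
    (hs : s ≠ ident) : ∃ f, Consistent yellow yellow f ∧ Consistent r s f := by
  by_cases h : r.IsGreen ∧ s.IsGreen
  · obtain ⟨⟨i, rfl⟩, ⟨i', rfl⟩⟩ := h
    rcases eq_or_ne i i' with rfl | hi
    · exact ⟨ident, by simp [conv], by simp [conv]⟩
    · obtain ⟨j, j', hj⟩ := exists_pair_ne Q
      exact ⟨red j j', consistent_yellow_yellow_red _ _, consistent_green_green_red.2 ⟨hi, hj⟩⟩
  · exact ⟨white, consistent_white (by simp) (by simp) (by simp [IsGreen]),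
      consistent_white hr hs h⟩

theorem exists_common_consistent [Nontrivial Q] {p q r s : Atom P Q} (hp : p ≠ ident)
    (hq : q ≠ ident) (hr : r ≠ ident) (hs : s ≠ ident) :
    ∃ f, Consistent p q f ∧ Consistent r s f := by
  by_cases h : p = yellow ∧ q = yellow
  · obtain ⟨rfl, rfl⟩ := h
    exact exists_consistent_yellow hr hs
  by_cases h' : r = yellow ∧ s = yellow
  · obtain ⟨rfl, rfl⟩ := h'
    obtain ⟨f, hf, hf'⟩ := exists_consistent_yellow hp hq
    exact ⟨f, hf', hf⟩
  exact ⟨black, consistent_black hp hq h, consistent_black hr hs h'⟩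

/-- After a Peircean transform, `f` is a common third side of the pairs `(b, c)` and `(a.conv, d)`.
If an identity atom is involved, `f` is forced. -/
theorem exists_consistent_assoc [Nontrivial Q] {a b c d e : Atom P Q} (h₁ : Consistent a b e)
    (h₂ : Consistent e c d) : ∃ f, Consistent b c f ∧ Consistent a f d := by
  by_cases ha : a = ident
  · subst ha
    obtain rfl := consistent_ident_left.1 h₁
    exact ⟨d, h₂, by simp⟩
  by_cases hb : b = ident
  · subst hb
    obtain rfl := consistent_ident_mid.1 h₁
    exact ⟨c, by simp, h₂⟩
  by_cases hc : c = ident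
  · subst hc
    obtain rfl := consistent_ident_mid.1 h₂
    exact ⟨b, by simp, h₁⟩
  by_cases hd : d = ident
  · subst hd
    obtain rfl := consistent_ident_right.1 h₂
    refine ⟨a.conv, ?_, by simp⟩
    exact consistent_conv_left.1 (consistent_conv_all.2 h₁)
  obtain ⟨f, hf, hf'⟩ := exists_common_consistent hb hc (mt conv_eq_ident.1 ha) hd
  exact ⟨f, hf, consistent_conv_left.1 hf'⟩

theorem exists_consistent_assoc' [Nontrivial Q] {a b c d f : Atom P Q} (h₁ : Consistent b c f)
    (h₂ : Consistent a f d) : ∃ e, Consistent a b e ∧ Consistent e c d := by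
  obtain ⟨e, he, he'⟩ := exists_consistent_assoc (consistent_conv_all.2 h₁)
    (consistent_conv_all.2 h₂)
  refine ⟨e.conv, ?_, ?_⟩
  · rw [← consistent_conv_all, conv_conv]; exact he
  · rw [← consistent_conv_all, conv_conv]; exact he'

end Atom

namespace Rainbow
variable {P Q : Type u}

/-- The set of atoms below an element of the rainbow algebra. -/
def atoms (X : Rainbow P Q) : Set (Atom P Q) := X

/-- The element of the rainbow algebra with the given atoms. -/
def ofAtoms (X : Set (Atom P Q)) : Rainbow P Q := X

@[simp] theorem atoms_ofAtoms (X : Set (Atom P Q)) : atoms (ofAtoms X) = X := rfl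

@[ext] theorem ext {X Y : Rainbow P Q} (h : ∀ a, a ∈ atoms X ↔ a ∈ atoms Y) : X = Y :=
  Set.ext h

@[simp] theorem atoms_zero : atoms (zero : Rainbow P Q) = ∅ := rfl
@[simp] theorem atoms_ident : atoms (RelAlg.ident : Rainbow P Q) = {Atom.ident} := rfl
@[simp] theorem atoms_neg (X : Rainbow P Q) : atoms (neg X) = (atoms X)ᶜ := rfl
@[simp] theorem atoms_add (X Y : Rainbow P Q) : atoms (add X Y) = atoms X ∪ atoms Y := rfl

@[simp] theorem mem_atoms_conv {X : Rainbow P Q} {a : Atom P Q} :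
    a ∈ atoms (RelAlg.conv X) ↔ a.conv ∈ atoms X :=
  ⟨fun ⟨b, hb, h⟩ => by rw [← h, conv_conv]; exact hb, fun h => ⟨_, h, conv_conv a⟩⟩

@[simp] theorem mem_atoms_comp {X Y : Rainbow P Q} {c : Atom P Q} :
    c ∈ atoms (comp X Y) ↔ ∃ a ∈ atoms X, ∃ b ∈ atoms Y, Consistent a b c := Iff.rfl

theorem isRelationAlgebra [Nontrivial Q] : IsRelationAlgebra (Rainbow P Q) where
  boolean := ⟨inferInstanceAs (BooleanAlgebra (Set (Atom P Q))), rfl, rfl, fun _ _ => rfl,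
    fun _ => rfl⟩
  comp_assoc X Y Z := by
    ext d
    constructor
    · rintro ⟨e, ⟨a, ha, b, hb, h₁⟩, c, hc, h₂⟩
      obtain ⟨f, hf, hf'⟩ := exists_consistent_assoc h₁ h₂
      exact ⟨a, ha, f, ⟨b, hb, c, hc, hf⟩, hf'⟩
    · rintro ⟨a, ha, f, ⟨b, hb, c, hc, h₁⟩, h₂⟩
      obtain ⟨e, he, he'⟩ := exists_consistent_assoc' h₁ h₂
      exact ⟨e, ⟨a, ha, b, hb, he⟩, c, hc, he'⟩
  ident_comp X := by ext; simp
  comp_ident X := by ext; simp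
  conv_conv X := by ext; simp
  conv_comp X Y := by
    ext c
    simp only [mem_atoms_conv, mem_atoms_comp]
    constructor
    · rintro ⟨a, ha, b, hb, h⟩
      refine ⟨b.conv, by simpa, a.conv, by simpa, ?_⟩
      rwa [← consistent_conv_all, conv_conv, conv_conv]
    · rintro ⟨b, hb, a, ha, h⟩
      exact ⟨a.conv, ha, b.conv, hb, consistent_conv_all.2 h⟩
  conv_zero := by ext; simp
  zero_comp X := by ext; simp
  comp_zero X := by ext; simp
  conv_add X Y := by ext; simp
  add_comp X Y Z := by
    ext; simp only [mem_atoms_comp, atoms_add, Set.mem_union, or_and_right, exists_or]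
  comp_add X Y Z := by
    ext; simp only [mem_atoms_comp, atoms_add, Set.mem_union, or_and_right, exists_or, and_or_left]
  peirce X Y := by
    ext c
    simp only [atoms_add, atoms_neg, Set.mem_union, Set.mem_compl_iff, or_iff_right_iff_imp,
      mem_atoms_comp, mem_atoms_conv]
    rintro ⟨a, ha, b, hb, h⟩ hc
    refine hb ⟨a.conv, ha, c, hc, consistent_conv_left.2 h⟩

end Rainbow
-- Representability forces |P| ≤ |Q|.
namespace Atom
variable {P Q : Type u}

instance [Finite P] [Finite Q] : Finite (Atom P Q) := by
  let f : Atom P Q → Option (Fin 3) ⊕ P ⊕ Q × Q := fun a => match a with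
    | .ident => .inl none
    | .black => .inl (some 0)
    | .white => .inl (some 1)
    | .yellow => .inl (some 2)
    | .green i => .inr (.inl i)
    | .red j j' => .inr (.inr (j, j'))
  refine Finite.of_injective f fun a b hab => ?_
  cases a <;> cases b <;> simp_all [f]

end Atom

section Embedding
variable {A B : Type u} [lang.Structure A] [lang.Structure B] (h : A ↪[lang] B)

theorem map_zero : h zero = zero :=
  (h.map_fun (Op.zero : lang.Functions 0) ![]).trans
    (congrArg _ (funext fun i => i.elim0))

theorem map_one : h one = one :=
  (h.map_fun (Op.one : lang.Functions 0) ![]).trans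
    (congrArg _ (funext fun i => i.elim0))

theorem map_neg (a : A) : h (neg a) = neg (h a) :=
  (h.map_fun (Op.neg : lang.Functions 1) ![a]).trans
    (congrArg _ (funext fun i => by fin_cases i; rfl))

theorem map_conv (a : A) : h (conv a) = conv (h a) :=
  (h.map_fun (Op.conv : lang.Functions 1) ![a]).trans
    (congrArg _ (funext fun i => by fin_cases i; rfl))

theorem map_add (a b : A) : h (add a b) = add (h a) (h b) :=
  (h.map_fun (Op.add : lang.Functions 2) ![a, b]).trans
    (congrArg _ (funext fun i => by fin_cases i <;> rfl))

theorem map_comp (a b : A) : h (comp a b) = comp (h a) (h b) :=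
  (h.map_fun (Op.comp : lang.Functions 2) ![a, b]).trans
    (congrArg _ (funext fun i => by fin_cases i <;> rfl))

end Embedding

namespace Rainbow
variable {P Q : Type u} {X : Type u} {E : Setoid X}

section
variable (h : Rainbow P Q ↪[lang] ProperAlgebra E)

theorem rel_of_mem {V : ProperAlgebra E} {x y : X} (hx : (x, y) ∈ V.1) : E.r x y :=
  V.2 (x, y) hx

theorem notMem_map_zero {x y : X} : (x, y) ∉ (h zero).1 := by
  rw [map_zero]; exact fun h => h

theorem mem_map_of_subset {V W : Rainbow P Q} (hVW : atoms V ⊆ atoms W) {x y : X}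
    (hx : (x, y) ∈ (h V).1) : (x, y) ∈ (h W).1 := by
  have : add V W = W := by ext a; simpa using @hVW a
  rw [← this, map_add]
  exact .inl hx

theorem disjoint_map {V W : Rainbow P Q} (hVW : ∀ a ∈ atoms V, a ∉ atoms W) {x y : X}
    (hx : (x, y) ∈ (h V).1) : (x, y) ∉ (h W).1 := by
  have : (x, y) ∈ (h (neg W)).1 := mem_map_of_subset h (fun a ha => hVW a ha) hx
  rw [map_neg] at this
  exact this.2

/-- An embedding preserves only finite joins, so finiteness of the atom set is essential. -/
theorem exists_atom_mem [Finite P] [Finite Q] {V : Rainbow P Q} {x y : X}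
    (hx : (x, y) ∈ (h V).1) : ∃ a ∈ atoms V, (x, y) ∈ (h (ofAtoms {a})).1 := by
  have hfin : (atoms V).Finite := Set.toFinite _
  obtain ⟨V, rfl⟩ : ∃ S, ofAtoms S = V := ⟨atoms V, rfl⟩
  simp only [atoms_ofAtoms] at *
  induction V, hfin using Set.Finite.induction_on with
  | empty => exact (notMem_map_zero h hx).elim
  | @insert a s _ _ ih =>
    have : ofAtoms (insert a s) = add (ofAtoms {a}) (ofAtoms s) := rfl
    rw [this, map_add] at hx
    rcases hx with hx | hx
    · exact ⟨a, .inl rfl, hx⟩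
    · obtain ⟨b, hb, hb'⟩ := ih hx
      exact ⟨b, .inr hb, hb'⟩

theorem atom_unique {x y : X} {a b : Atom P Q} (ha : (x, y) ∈ (h (ofAtoms {a})).1)
    (hb : (x, y) ∈ (h (ofAtoms {b})).1) : a = b := by
  by_contra hne
  exact disjoint_map h (by simpa using hne) ha hb

theorem mem_map_conv {x y : X} {a : Atom P Q} (ha : (x, y) ∈ (h (ofAtoms {a})).1) :
    (y, x) ∈ (h (ofAtoms {a.conv})).1 := by
  have : ofAtoms {a.conv} = RelAlg.conv (ofAtoms {a}) := by
    ext b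
    simpa using ⟨fun h => by simp [h], fun h => by simp [← h]⟩
  rw [this, map_conv]
  exact ha

theorem consistent_of_mem {x y z : X} {a b c : Atom P Q} (ha : (x, y) ∈ (h (ofAtoms {a})).1)
    (hb : (y, z) ∈ (h (ofAtoms {b})).1) (hc : (x, z) ∈ (h (ofAtoms {c})).1) :
    Consistent a b c := by
  by_contra hne
  refine disjoint_map h (W := comp (ofAtoms {a}) (ofAtoms {b})) (by simpa using hne) hc ?_
  rw [map_comp]
  exact ⟨y, ha, hb⟩

theorem exists_of_consistent {x y : X} {a b c : Atom P Q} (hc : (x, y) ∈ (h (ofAtoms {c})).1)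
    (habc : Consistent a b c) :
    ∃ z, (x, z) ∈ (h (ofAtoms {a})).1 ∧ (z, y) ∈ (h (ofAtoms {b})).1 := by
  have : (x, y) ∈ (h (comp (ofAtoms {a}) (ofAtoms {b}))).1 :=
    mem_map_of_subset h (by simpa using habc) hc
  rw [map_comp] at this
  exact this

/-- Otherwise the atom and `zero` would have the same image, against injectivity. -/
theorem exists_mem_map (a : Atom P Q) : ∃ x y, (x, y) ∈ (h (ofAtoms {a})).1 := by
  by_contra! hne
  have : h (ofAtoms {a}) = h zero := by
    apply Subtype.ext
    ext ⟨x, y⟩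
    exact iff_of_false (hne x y) (notMem_map_zero h)
  have := congrArg atoms (h.injective this)
  simp at this

end

/-- A representation of a finite rainbow algebra yields an injection from the indices of the
green atoms to those of the red atoms. -/
theorem exists_injective_of_embedding (h : Rainbow P Q ↪[lang] ProperAlgebra E) [Finite P] [Finite Q] [Nonempty Q] :
    ∃ ρ : P → Q, Function.Injective ρ := by
  obtain ⟨x, y, hxy⟩ := exists_mem_map h black
  -- Black is excluded only by two yellows, so every green index gets a point over the same black
  -- edge.
  have hz : ∀ i, ∃ z, (x, z) ∈ (h (ofAtoms {green i})).1 ∧ (z, y) ∈ (h (ofAtoms {yellow})).1 :=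
    fun i => exists_of_consistent h hxy (consistent_black (by simp) (by simp) (by simp))
  choose z hxz hzy using hz
  have hl : ∀ i i', ∃ a, (z i, z i') ∈ (h (ofAtoms {a})).1 := by
    intro i i'
    have : (z i, z i') ∈ (h one).1 := by
      rw [map_one]
      exact E.iseqv.trans (E.iseqv.symm (rel_of_mem (hxz i))) (rel_of_mem (hxz i'))
    obtain ⟨a, -, ha⟩ := exists_atom_mem h this
    exact ⟨a, ha⟩
  choose l hl using hl
  obtain ⟨ρ, hρ, -⟩ := exists_red_indexing l
    (fun w w' => atom_unique h (hl w' w) (mem_map_conv h (hl w w')))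
    (fun w₁ w₂ w₃ => consistent_of_mem h (hl _ _) (hl _ _) (hl _ _)) (fun i i' hne => by
      have hg : Consistent (green i) (green i') (l i i') :=
        consistent_of_mem h (mem_map_conv h (hxz i)) (hxz i') (hl i i')
      have hy : Consistent yellow yellow (l i i') :=
        consistent_of_mem h (hzy i) (mem_map_conv h (hzy i')) (hl i i')
      rcases eq_ident_or_red hg hy with ⟨-, h⟩ | ⟨j, j', h, -, hj⟩
      · exact (hne h).elim
      · exact ⟨j, j', h, hj⟩)
  exact ⟨ρ, hρ⟩

end Rainbow
-- Similarity along relations between green indices.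
namespace Atom
variable {P P' Q : Type u}

/-- The relation between atoms induced by a relation between the indices of green atoms. -/
inductive LiftRel (r : P → P' → Prop) : Atom P Q → Atom P' Q → Prop
  | ident : LiftRel r ident ident
  | black : LiftRel r black black
  | white : LiftRel r white white
  | yellow : LiftRel r yellow yellow
  | green {i i'} : r i i' → LiftRel r (green i) (green i')
  | red (j j') : LiftRel r (red j j') (red j j')

variable {r s : P → P' → Prop} {a b c : Atom P Q} {a' b' c' : Atom P' Q}

theorem LiftRel.flip (h : LiftRel r a a') : LiftRel (flip r) a' a := by
  cases h <;> constructor; assumption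

theorem LiftRel.mono (hrs : ∀ i i', r i i' → s i i') (h : LiftRel r a a') : LiftRel s a a' := by
  cases h <;> constructor; exact hrs _ _ ‹_›

theorem LiftRel.conv (h : LiftRel r a a') : LiftRel r a.conv a'.conv := by
  cases h <;> constructor; assumption

theorem liftRel_ident_iff (h : LiftRel r a a') : a = Atom.ident ↔ a' = Atom.ident := by
  cases h <;> simp

theorem LiftRel.of_not_isGreen (h : LiftRel r a a') (ha : ¬ a.IsGreen) : LiftRel s a a' := by
  cases h <;> first | exact (ha ⟨_, rfl⟩).elim | constructor

theorem exists_liftRel (h : ∀ i, a = green i → ∃ i', r i i') :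
    ∃ a' : Atom P' Q, LiftRel r a a' := by
  cases a with
  | green i => exact (h i rfl).imp' _ fun _ => .green
  | _ => exact ⟨_, by constructor⟩

theorem LiftRel.rightUnique (hr : Relator.RightUnique r) (h : LiftRel r a a')
    (h' : LiftRel r a b') : a' = b' := by
  cases h <;> cases h' <;> first | rfl | exact congrArg _ (hr ‹_› ‹_›)

theorem LiftRel.leftUnique (hr : Relator.LeftUnique r) (h : LiftRel r a a')
    (h' : LiftRel r b a') : a = b :=
  LiftRel.rightUnique (r := _root_.flip r) (fun _ _ _ h h' => hr h h') h.flip h'.flip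

/-- The forbidden patterns mention green indices only through equality, which a bi-unique relation
respects. -/
theorem LiftRel.basicForbidden (hr : Relator.BiUnique r) (ha : LiftRel r a a')
    (hb : LiftRel r b b') (hc : LiftRel r c c') (h : BasicForbidden a b c) :
    BasicForbidden a' b' c' := by
  cases h with
  | ident a b hne =>
    cases ha
    exact .ident _ _ fun h => hne (LiftRel.leftUnique hr.1 hb (h ▸ hc))
  | ggg => cases ha; cases hb; cases hc; exact .ggg _ _ _
  | ggw => cases ha; cases hb; cases hc; exact .ggw _ _
  | yyy => cases ha; cases hb; cases hc; exact .yyy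
  | yyb => cases ha; cases hb; cases hc; exact .yyb
  | rrr => cases ha; cases hb; cases hc; exact .rrr _ _ _ _ _ _ ‹_›
  | ggr_same =>
    obtain rfl := LiftRel.rightUnique hr.2 ha hb
    cases ha; cases hc; exact .ggr_same _ _ _
  | ggr_diag => cases ha; cases hb; cases hc; exact .ggr_diag _ _ _

/-- Being consistent is a negation, so forbidden triples are pulled back along the flipped relation.
-/
theorem LiftRel.consistent (hr : Relator.BiUnique r) (ha : LiftRel r a a')
    (hb : LiftRel r b b') (hc : LiftRel r c c') (h : Consistent a b c) : Consistent a' b' c' := by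
  have hr' : Relator.BiUnique (_root_.flip r) :=
    ⟨fun _ _ _ h h' => hr.2 h h', fun _ _ _ h h' => hr.1 h h'⟩
  replace ha := ha.flip
  replace hb := hb.flip
  replace hc := hc.flip
  refine fun h' => h ?_
  rcases h' with h' | h' | h' | h' | h' | h'
  · exact .inl (LiftRel.basicForbidden hr' ha hb hc h')
  · exact .inr (.inl (LiftRel.basicForbidden hr' ha.conv hc hb h'))
  · exact .inr (.inr (.inl (LiftRel.basicForbidden hr' hc hb.conv ha h')))
  · exact .inr (.inr (.inr (.inl (LiftRel.basicForbidden hr' hb hc.conv ha.conv h'))))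
  · exact .inr (.inr (.inr (.inr (.inl (LiftRel.basicForbidden hr' hc.conv ha hb.conv h')))))
  · exact .inr (.inr (.inr (.inr (.inr (LiftRel.basicForbidden hr' hb.conv ha.conv hc.conv h')))))

/-- A relation between index sets along which one can extend injectively by one more index. -/
structure OneExtending (r : P → P' → Prop) : Prop where
  total : ∀ i, ∃ i', r i i'
  extend : ∀ i₁ i₁' i₂, r i₁ i₁' → ∃ i₂', r i₂ i₂' ∧ (i₁ = i₂ ↔ i₁' = i₂')

theorem OneExtending.exists_biUnique (hr : OneExtending r) {i₁ : P} {i₁' : P'} (h : r i₁ i₁')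
    (i₂ : P) : ∃ s : P → P' → Prop, Relator.BiUnique s ∧ (∀ i i', s i i' → r i i') ∧ s i₁ i₁' ∧
      ∃ i₂', s i₂ i₂' := by
  obtain ⟨i₂', h', he⟩ := hr.extend i₁ i₁' i₂ h
  refine ⟨fun k k' => (k = i₁ ∧ k' = i₁') ∨ (k = i₂ ∧ k' = i₂'), ⟨?_, ?_⟩, ?_, by simp,
    i₂', by simp⟩
  · rintro a b c (⟨rfl, rfl⟩ | ⟨rfl, rfl⟩) (⟨rfl, h2⟩ | ⟨rfl, h2⟩) <;> grind
  · rintro a b c (⟨rfl, rfl⟩ | ⟨rfl, rfl⟩) (⟨h1, rfl⟩ | ⟨h1, rfl⟩) <;> grind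
  · rintro i i' (⟨rfl, rfl⟩ | ⟨rfl, rfl⟩) <;> assumption

/-- A consistent triple has at most two green atoms, so a bi-unique part of `r` with at most two
pairs carries it over. When there is only one green, `exists_biUnique` is used with both indices
equal. -/
theorem OneExtending.exists_consistent (hr : OneExtending r) (hc : LiftRel r c c')
    (h : Consistent a b c) :
    ∃ a' b', LiftRel r a a' ∧ LiftRel r b b' ∧ Consistent a' b' c' := by
  suffices ∃ s : P → P' → Prop, Relator.BiUnique s ∧ (∀ i i', s i i' → r i i') ∧
      LiftRel s c c' ∧ (∀ i, a = green i → ∃ i', s i i') ∧ ∀ i, b = green i → ∃ i', s i i' by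
    obtain ⟨s, hs, hsr, hc', ha, hb⟩ := this
    obtain ⟨a', ha'⟩ := exists_liftRel (Q := Q) ha
    obtain ⟨b', hb'⟩ := exists_liftRel (Q := Q) hb
    exact ⟨a', b', ha'.mono hsr, hb'.mono hsr, ha'.consistent hs hb' hc' h⟩
  by_cases hcg : c.IsGreen
  · obtain ⟨i, rfl⟩ := hcg
    cases hc with | @green _ i' hi =>
    by_cases hag : a.IsGreen
    · obtain ⟨k, rfl⟩ := hag
      obtain ⟨s, hs, hsr, hi', hk⟩ := hr.exists_biUnique hi k
      refine ⟨s, hs, hsr, .green hi', by simpa using hk, ?_⟩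
      rintro l rfl
      -- A third green would make the triple forbidden.
      exact (h (.inl (.ggg _ _ _))).elim
    · by_cases hbg : b.IsGreen
      · obtain ⟨k, rfl⟩ := hbg
        obtain ⟨s, hs, hsr, hi', hk⟩ := hr.exists_biUnique hi k
        exact ⟨s, hs, hsr, .green hi', fun l hl => (hag ⟨l, hl⟩).elim, by simpa using hk⟩
      · obtain ⟨s, hs, hsr, hi', hk⟩ := hr.exists_biUnique hi i
        exact ⟨s, hs, hsr, .green hi', fun l hl => (hag ⟨l, hl⟩).elim,
          fun l hl => (hbg ⟨l, hl⟩).elim⟩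
  · by_cases hag : a.IsGreen
    · obtain ⟨i, rfl⟩ := hag
      obtain ⟨i', hi⟩ := hr.total i
      by_cases hbg : b.IsGreen
      · obtain ⟨k, rfl⟩ := hbg
        obtain ⟨s, hs, hsr, hi', hk⟩ := hr.exists_biUnique hi k
        exact ⟨s, hs, hsr, hc.of_not_isGreen hcg, by simpa using ⟨i', hi'⟩, by simpa using hk⟩
      · obtain ⟨s, hs, hsr, hi', hk⟩ := hr.exists_biUnique hi i
        exact ⟨s, hs, hsr, hc.of_not_isGreen hcg, by simpa using hk,
          fun l hl => (hbg ⟨l, hl⟩).elim⟩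
    · by_cases hbg : b.IsGreen
      · obtain ⟨i, rfl⟩ := hbg
        obtain ⟨i', hi⟩ := hr.total i
        obtain ⟨s, hs, hsr, hi', hk⟩ := hr.exists_biUnique hi i
        exact ⟨s, hs, hsr, hc.of_not_isGreen hcg, fun l hl => (hag ⟨l, hl⟩).elim,
          by simpa using hk⟩
      · exact ⟨fun _ _ => False, ⟨fun _ _ _ h => h.elim, fun _ _ _ h => h.elim⟩,
          fun _ _ h => h.elim, hc.of_not_isGreen hcg, fun l hl => (hag ⟨l, hl⟩).elim,
          fun l hl => (hbg ⟨l, hl⟩).elim⟩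

end Atom

namespace Rainbow
variable {P P' Q : Type u} {r s : P → P' → Prop} {X Y : Rainbow P Q} {X' Y' : Rainbow P' Q}

/-- Two elements of rainbow algebras are similar if they contain the same atoms up to `r`. -/
def Similar (r : P → P' → Prop) (X : Rainbow P Q) (X' : Rainbow P' Q) : Prop :=
  ∀ a a', LiftRel r a a' → (a ∈ atoms X ↔ a' ∈ atoms X')

theorem Similar.flip (h : Similar r X X') : Similar (flip r) X' X :=
  fun _ _ ha => (h _ _ ha.flip).symm

theorem Similar.mono (hsr : ∀ i i', s i i' → r i i') (h : Similar r X X') : Similar s X X' :=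
  fun _ _ ha => h _ _ (ha.mono hsr)

/-- Every atom on the primed side is related to one on the other side, so similarity to a single
element determines an element. -/
theorem Similar.ext (hr : OneExtending (_root_.flip r)) (hX : Similar r X X')
    (hY : Similar r Y Y') (h : X = Y) : X' = Y' := by
  subst h
  ext a'
  obtain ⟨a, ha⟩ := exists_liftRel (Q := Q) (a := a') fun i _ => hr.total i
  rw [← hX _ _ ha.flip, ← hY _ _ ha.flip]

theorem Similar.neg (h : Similar r X X') : Similar r (neg X) (neg X') :=
  fun a a' ha => not_congr (h a a' ha)

theorem Similar.add (hX : Similar r X X') (hY : Similar r Y Y') :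
    Similar r (add X Y) (add X' Y') :=
  fun a a' ha => or_congr (hX a a' ha) (hY a a' ha)

theorem Similar.conv (h : Similar r X X') : Similar r (RelAlg.conv X) (RelAlg.conv X') := by
  intro a a' ha
  rw [mem_atoms_conv, mem_atoms_conv]
  exact h _ _ ha.conv

theorem Similar.comp (hr : OneExtending r) (hr' : OneExtending (_root_.flip r))
    (hX : Similar r X X') (hY : Similar r Y Y') : Similar r (comp X Y) (comp X' Y') := by
  intro c c' hc
  constructor
  · rintro ⟨a, ha, b, hb, h⟩
    obtain ⟨a', b', ha', hb', h'⟩ := hr.exists_consistent hc h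
    exact ⟨a', (hX _ _ ha').1 ha, b', (hY _ _ hb').1 hb, h'⟩
  · rintro ⟨a', ha, b', hb, h⟩
    obtain ⟨a, b, ha', hb', h'⟩ := hr'.exists_consistent hc.flip h
    exact ⟨a, (hX _ _ ha'.flip).2 ha, b, (hY _ _ hb'.flip).2 hb, h'⟩

theorem Similar.realize_term {α : Type*} (hr : OneExtending r)
    (hr' : OneExtending (_root_.flip r)) {v : α → Rainbow P Q} {v' : α → Rainbow P' Q}
    (hv : ∀ x, Similar r (v x) (v' x)) (t : lang.Term α) :
    Similar r (t.realize v) (t.realize v') := by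
  induction t with
  | var x => exact hv x
  | func f ts ih =>
    cases f with
    | zero => exact fun _ _ _ => Iff.rfl
    | one => exact fun _ _ _ => Iff.rfl
    | ident => exact fun a a' h => liftRel_ident_iff h
    | neg => exact (ih 0).neg
    | conv => exact (ih 0).conv
    | add => exact (ih 0).add (ih 1)
    | comp => exact (ih 0).comp hr hr' (ih 1)

/-! ### Colour classes and the back-and-forth argument. -/

/-- Numbers that are equal or both at least `N`. -/
def EqUpTo (N a b : ℕ) : Prop := a = b ∨ (N ≤ a ∧ N ≤ b)

theorem EqUpTo.symm {N a b : ℕ} (h : EqUpTo N a b) : EqUpTo N b a :=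
  h.imp Eq.symm And.symm

/-- A part of size at most `N` is copied exactly, and the rest is then at least `N` on both sides.
If both parts are large, `N` and `b - N` serve. -/
theorem EqUpTo.exists_split {N p q b : ℕ} (h : EqUpTo (2 * N) (p + q) b) :
    ∃ p' q', p' + q' = b ∧ EqUpTo N p p' ∧ EqUpTo N q q' := by
  unfold EqUpTo at *
  rcases h with h | ⟨h, h'⟩
  · exact ⟨p, q, h, by simp⟩
  rcases le_total p N with hp | hp
  · exact ⟨p, b - p, by omega, by omega, by omega⟩
  rcases le_total q N with hq | hq
  · exact ⟨b - q, q, by omega, by omega, by omega⟩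
  · exact ⟨N, b - N, by omega, by omega, by omega⟩

variable {C : Type*} {κ : P → C} {κ' : P' → C}

/-- Two colourings have the same colour classes up to sizes at least `N`. -/
def SameFibers (N : ℕ) (κ : P → C) (κ' : P' → C) : Prop :=
  ∀ c, EqUpTo N (κ ⁻¹' {c}).ncard (κ' ⁻¹' {c}).ncard

theorem SameFibers.symm {N : ℕ} (h : SameFibers N κ κ') : SameFibers N κ' κ :=
  fun c => (h c).symm

/-- Threshold 2 distinguishes classes with no, one or several elements, which is all that is needed
to find a second index different from the first. -/
theorem SameFibers.oneExtending [Finite P] {N : ℕ} (hN : 2 ≤ N)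
    (h : SameFibers N κ κ') : OneExtending fun i i' => κ i = κ' i' := by
  have htot : ∀ i, ∃ i', κ i = κ' i' := by
    intro i
    have hpos : 0 < (κ ⁻¹' {κ i}).ncard := (Set.ncard_pos (Set.toFinite _)).2 ⟨i, rfl⟩
    obtain ⟨i', hi'⟩ : (κ' ⁻¹' {κ i}).Nonempty := by
      apply Set.nonempty_of_ncard_ne_zero
      rcases h (κ i) with h | h <;> omega
    exact ⟨i', hi'.symm⟩
  refine ⟨htot, fun i₁ i₁' i₂ h₁ => ?_⟩
  rcases eq_or_ne i₁ i₂ with rfl | hne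
  · exact ⟨i₁', h₁, by simp⟩
  by_cases h₂ : κ i₁ = κ i₂
  · have h1 : 1 < (κ ⁻¹' {κ i₂}).ncard :=
      (Set.one_lt_ncard (Set.toFinite _)).2 ⟨i₁, h₂, i₂, rfl, hne⟩
    have h2 : 1 < (κ' ⁻¹' {κ i₂}).ncard := by
      rcases h (κ i₂) with h | h <;> omega
    obtain ⟨i₂', hi, hi'⟩ := Set.exists_ne_of_one_lt_ncard h2 i₁'
    exact ⟨i₂', hi.symm, iff_of_false hne hi'.symm⟩
  · obtain ⟨i₂', hi⟩ := htot i₂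
    refine ⟨i₂', hi, iff_of_false hne ?_⟩
    rintro rfl
    exact h₂ (h₁.trans hi.symm)

/-- Each colour class is split separately by `EqUpTo.exists_split`, and the chosen parts are glued
together. -/
theorem SameFibers.exists_set [Finite P] [Finite P'] {N : ℕ} (h : SameFibers (2 * N) κ κ')
    (A : Set P) : ∃ A' : Set P',
      SameFibers N (fun i => (κ i, i ∈ A)) (fun i => (κ' i, i ∈ A')) := by
  have key : ∀ c, ∃ B ⊆ κ' ⁻¹' {c}, EqUpTo N (κ ⁻¹' {c} ∩ A).ncard B.ncard ∧
      EqUpTo N (κ ⁻¹' {c} \ A).ncard (κ' ⁻¹' {c} \ B).ncard := by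
    intro c
    have hc := h c
    rw [← Set.ncard_inter_add_ncard_sdiff_eq_ncard (κ ⁻¹' {c}) A (Set.toFinite _)] at hc
    obtain ⟨p, q, hpq, hp, hq⟩ := hc.exists_split
    obtain ⟨B, hB, hBp⟩ := Set.exists_subset_card_eq (s := κ' ⁻¹' {c}) (n := p) (by omega)
    refine ⟨B, hB, hBp.symm ▸ hp, ?_⟩
    rw [Set.ncard_sdiff hB (Set.toFinite _), hBp, ← hpq, Nat.add_sub_cancel_left]
    exact hq
  choose B hB hp hq using key
  refine ⟨{i | i ∈ B (κ' i)}, ?_⟩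
  rintro ⟨c, t⟩
  have hsub : ∀ i ∈ B c, κ' i = c := fun i hi => hB c hi
  by_cases ht : t
  · convert hp c using 2
    · ext i; simp [ht]
    · ext i
      simp only [Set.mem_preimage, Set.mem_singleton_iff, Prod.mk.injEq, Set.mem_ofPred_eq, ht,
        eq_iff_iff, iff_true]
      exact ⟨fun ⟨h, h'⟩ => h ▸ h', fun h => ⟨hsub i h, (hsub i h).symm ▸ h⟩⟩
  · convert hq c using 2
    · ext i; simp [ht]
    · ext i
      simp only [Set.mem_preimage, Set.mem_singleton_iff, Prod.mk.injEq, Set.mem_ofPred_eq, ht,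
        eq_iff_iff, iff_false, Set.mem_sdiff]
      exact and_congr_right fun h => by rw [h]

/-- The back-and-forth step. -/
theorem SameFibers.exists_similar [Finite P] [Finite P'] {N : ℕ} {C : Type} {κ : P → C}
    {κ' : P' → C} (h : SameFibers (2 * N) κ κ') (X : Rainbow P Q) :
    ∃ (X' : Rainbow P' Q) (D : Type) (μ : P → D) (μ' : P' → D), SameFibers N μ μ' ∧
      (∀ i i', μ i = μ' i' → κ i = κ' i') ∧ Similar (fun i i' => μ i = μ' i') X X' := by
  obtain ⟨A', hA'⟩ := h.exists_set {i | green i ∈ atoms X}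
  -- Non-green atoms are copied; on green atoms the answer is `A'`. The refined colour records
  -- membership, so similarity holds by construction.
  refine ⟨ofAtoms {a' | match a' with
    | .ident => Atom.ident ∈ atoms X
    | .black => black ∈ atoms X
    | .white => white ∈ atoms X
    | .yellow => yellow ∈ atoms X
    | .green i => i ∈ A'
    | .red j j' => red j j' ∈ atoms X}, _, _, _, hA', fun i i' h => congrArg Prod.fst h, ?_⟩
  intro a a' ha
  cases ha with
  | green h => exact iff_of_eq (congrArg Prod.snd h)
  | _ => exact Iff.rfl

/-- `k` bounds the remaining depth. The exponent `k + 1` leaves threshold 2 for atomic formulas, as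
`SameFibers.oneExtending` requires. -/
theorem realize_iff [Finite P] [Finite P'] {m : ℕ} (φ : lang.BoundedFormula Empty m) :
    ∀ {k : ℕ}, quantifierDepth φ ≤ k → ∀ {C : Type} {κ : P → C} {κ' : P' → C},
      SameFibers (2 ^ (k + 1)) κ κ' → ∀ {x : Empty → Rainbow P Q} {x' : Empty → Rainbow P' Q}
        {v : Fin m → Rainbow P Q} {v' : Fin m → Rainbow P' Q},
        (∀ i, Similar (fun i i' => κ i = κ' i') (v i) (v' i)) →
          (φ.Realize x v ↔ φ.Realize x' v') := by
  have two_le : ∀ k : ℕ, 2 ≤ 2 ^ (k + 1) := fun k => Nat.le_self_pow (by omega) 2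
  have flip_eq : ∀ {C : Type} (κ : P → C) (κ' : P' → C),
      (flip fun i i' => κ i = κ' i') = fun i' i => κ' i' = κ i := fun κ κ' => by
    funext i' i; exact propext eq_comm
  induction φ with
  | falsum => exact fun _ _ _ _ _ _ _ _ _ _ => Iff.rfl
  | equal t₁ t₂ =>
    intro k _ C κ κ' h x x' v v' hv
    have hr := h.oneExtending (two_le k)
    have hr' := h.symm.oneExtending (two_le k)
    rw [← flip_eq] at hr'
    have hx : ∀ y, Similar (fun i i' => κ i = κ' i') (Sum.elim x v y) (Sum.elim x' v' y) := by
      rintro (y | y)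
      exacts [y.elim, hv y]
    have h₁ := Similar.realize_term hr hr' hx t₁
    have h₂ := Similar.realize_term hr hr' hx t₂
    exact ⟨Similar.ext hr' h₁ h₂, Similar.ext hr h₁.flip h₂.flip⟩
  | rel R => exact R.elim
  | imp φ ψ ihφ ihψ =>
    intro k hk C κ κ' h x x' v v' hv
    simp only [quantifierDepth, max_le_iff] at hk
    exact imp_congr (ihφ hk.1 h hv) (ihψ hk.2 h hv)
  | all φ ih =>
    intro k hk C κ κ' h x x' v v' hv
    simp only [quantifierDepth] at hk
    obtain ⟨k, rfl⟩ : ∃ l, k = l + 1 := ⟨k - 1, by omega⟩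
    -- One quantifier costs one halving of the threshold.
    rw [pow_succ, mul_comm] at h
    constructor
    · intro hφ X'
      obtain ⟨X, D, μ, μ', hμ, hκ, hX⟩ := h.symm.exists_similar X'
      refine (ih (by omega) hμ.symm fun i => ?_).1 (hφ X)
      induction i using Fin.lastCases with
      | last => simpa [← flip_eq, Fin.snoc_last] using hX.flip
      | cast i =>
        simpa [Fin.snoc_castSucc] using (hv i).mono fun i i' h => (hκ i' i h.symm).symm
    · intro hφ X
      obtain ⟨X', D, μ, μ', hμ, hκ, hX⟩ := h.exists_similar X
      refine (ih (by omega) hμ fun i => ?_).2 (hφ X')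
      induction i using Fin.lastCases with
      | last => simpa [Fin.snoc_last] using hX
      | cast i => simpa [Fin.snoc_castSucc] using (hv i).mono hκ

theorem models_iff [Finite P] [Finite P'] {n : ℕ} (hP : 2 ^ (n + 1) ≤ Nat.card P)
    (hP' : 2 ^ (n + 1) ≤ Nat.card P') (φ : lang.Sentence) (hφ : quantifierDepth φ ≤ n) :
    Rainbow P Q ⊨ φ ↔ Rainbow P' Q ⊨ φ := by
  -- Before any move there is one colour, whose class consists of all green indices.
  refine realize_iff φ hφ (κ := fun _ => ()) (κ' := fun _ => ()) (fun c => .inr ?_)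
    fun i => i.elim0
  simpa [Set.preimage_const, Set.ncard_univ] using ⟨hP, hP'⟩

end Rainbow
-- Finite networks and their one-point extensions.
namespace Atom
variable {P Q : Type u}

theorem consistent_white_white (l : Atom P Q) : Consistent white l white := by
  by_cases h : l = ident
  · simp [h]
  · exact consistent_white (by simp) h (by simp [IsGreen])

theorem consistent_black_black (l : Atom P Q) : Consistent black l black := by
  by_cases h : l = ident
  · simp [h]
  · exact consistent_black (by simp) h (by simp)

end Atom

variable {P Q : Type u}

/-- A finite consistent labelling of pairs of natural numbers by atoms. -/
structure Network (P Q : Type u) where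
  /-- The vertices. -/
  verts : Finset ℕ
  /-- The labels. -/
  label : ℕ → ℕ → Atom P Q
  label_eq_ident : ∀ x ∈ verts, ∀ y ∈ verts, label x y = Atom.ident ↔ x = y
  label_conv : ∀ x ∈ verts, ∀ y ∈ verts, label y x = (label x y).conv
  consistent : ∀ x ∈ verts, ∀ y ∈ verts, ∀ z ∈ verts,
    Consistent (label x y) (label y z) (label x z)

namespace Network

/-- The order is extension of networks. It is not antisymmetric, because labels off the vertex set
are arbitrary. -/
instance : Preorder (Network P Q) where
  le N M := N.verts ⊆ M.verts ∧ ∀ x ∈ N.verts, ∀ y ∈ N.verts, M.label x y = N.label x y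
  le_refl N := ⟨subset_rfl, fun _ _ _ _ => rfl⟩
  le_trans N M K h h' := ⟨h.1.trans h'.1, fun x hx y hy =>
    (h'.2 x (h.1 hx) y (h.1 hy)).trans (h.2 x hx y hy)⟩

instance : Inhabited (Network P Q) where
  default :=
    { verts := {0}
      label := fun _ _ => Atom.ident
      label_eq_ident := by simp
      label_conv := fun _ _ _ _ => rfl
      consistent := fun _ _ _ _ _ _ => consistent_ident_left.2 rfl }

variable (N : Network P Q)

theorem label_self {x : ℕ} (hx : x ∈ N.verts) : N.label x x = Atom.ident :=
  (N.label_eq_ident x hx x hx).2 rfl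

theorem consistent_symm {w w' : ℕ} (hw : w ∈ N.verts) (hw' : w' ∈ N.verts) {a b : Atom P Q}
    (h : Consistent a (N.label w w') b) : Consistent b (N.label w' w) a := by
  rw [N.label_conv w hw w' hw']
  exact consistent_conv_mid.2 h

/-- A network can be extended by a new vertex with prescribed consistent labels. -/
theorem exists_extension {z : ℕ} (hz : z ∉ N.verts) (μ : ℕ → Atom P Q)
    (hμ : ∀ w ∈ N.verts, μ w ≠ Atom.ident)
    (hc : ∀ w ∈ N.verts, ∀ w' ∈ N.verts, Consistent (μ w) (N.label w w') (μ w')) :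
    ∃ M, N ≤ M ∧ z ∈ M.verts ∧ ∀ w ∈ N.verts, M.label z w = μ w ∧ M.label w z = (μ w).conv := by
  let L : ℕ → ℕ → Atom P Q := fun x y =>
    if x = z then if y = z then Atom.ident else μ y
    else if y = z then (μ x).conv else N.label x y
  have hne : ∀ w ∈ N.verts, w ≠ z := fun w hw h => hz (h ▸ hw)
  have L₀ : L z z = Atom.ident := by simp [L]
  have L₁ : ∀ w ∈ N.verts, L z w = μ w := fun w hw => by simp [L, hne w hw]
  have L₂ : ∀ w ∈ N.verts, L w z = (μ w).conv := fun w hw => by simp [L, hne w hw]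
  have L₃ : ∀ w ∈ N.verts, ∀ w' ∈ N.verts, L w w' = N.label w w' :=
    fun w hw w' hw' => by simp [L, hne w hw, hne w' hw']
  refine ⟨⟨insert z N.verts, L, ?_, ?_, ?_⟩, ⟨Finset.subset_insert _ _, L₃⟩,
    Finset.mem_insert_self _ _, fun w hw => ⟨L₁ w hw, L₂ w hw⟩⟩
  · intro x hx y hy
    rcases Finset.mem_insert.1 hx with rfl | hx' <;> rcases Finset.mem_insert.1 hy with rfl | hy'
    · simp [L₀]
    · simp [L₁ y hy', hμ y hy', (hne y hy').symm]
    · simp [L₂ x hx', hμ x hx', hne x hx']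
    · rw [L₃ x hx' y hy', N.label_eq_ident x hx' y hy']
  · intro x hx y hy
    rcases Finset.mem_insert.1 hx with rfl | hx' <;> rcases Finset.mem_insert.1 hy with rfl | hy'
    · rw [L₀]; rfl
    · rw [L₁ y hy', L₂ y hy']
    · rw [L₁ x hx', L₂ x hx', conv_conv]
    · rw [L₃ x hx' y hy', L₃ y hy' x hx', N.label_conv x hx' y hy']
  · intro x hx y hy w hw
    rcases Finset.mem_insert.1 hx with rfl | hx'
    · rcases Finset.mem_insert.1 hy with rfl | hy'
      · simp [L₀]
      · rcases Finset.mem_insert.1 hw with rfl | hw'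
        · rw [L₀, L₁ y hy', L₂ y hy', consistent_ident_right]
        · rw [L₁ y hy', L₁ w hw', L₃ y hy' w hw']
          exact hc y hy' w hw'
    · rcases Finset.mem_insert.1 hy with rfl | hy'
      · rcases Finset.mem_insert.1 hw with rfl | hw'
        · simp [L₀]
        · rw [L₂ x hx', L₁ w hw', L₃ x hx' w hw', consistent_conv_left]
          exact hc x hx' w hw'
      · rcases Finset.mem_insert.1 hw with rfl | hw'
        · rw [L₂ x hx', L₂ y hy', L₃ x hx' y hy', N.label_conv y hy' x hx', consistent_conv_all]
          exact hc y hy' x hx'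
        · rw [L₃ x hx' y hy', L₃ y hy' w hw', L₃ x hx' w hw']
          exact N.consistent x hx' y hy' w hw'

/-- The vertices joined to `x` by a green edge and to `y` by a yellow edge. -/
def cone (x y : ℕ) : Set ℕ := {w | w ∈ N.verts ∧ (N.label x w).IsGreen ∧ N.label y w = yellow}

/-- A cone is indexed by red indices, not using all of them if some green index does not occur
in the cone. -/
theorem exists_cone_indexing [Finite P] [Finite Q] (hPQ : Nat.card P ≤ Nat.card Q) {x y : ℕ}
    (hx : x ∈ N.verts) (hy : y ∈ N.verts) {i : P}
    (hi : ∀ w ∈ N.cone x y, N.label x w ≠ green i) :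
    ∃ (ρ : ℕ → Q) (k : Q), (∀ w ∈ N.cone x y, k ≠ ρ w) ∧
      ∀ w ∈ N.cone x y, ∀ w' ∈ N.cone x y, w ≠ w' → N.label w w' = red (ρ w) (ρ w') := by
  classical
  have hQ : Nonempty Q := by
    have : Nonempty P := ⟨i⟩
    exact (Nat.card_pos_iff.1 (Nat.card_pos.trans_le hPQ)).1
  have htint : ∀ w : N.cone x y, ∃ t, N.label x w = green t := fun w => w.2.2.1
  choose t ht using htint
  have hred : ∀ w w' : N.cone x y, w ≠ w' →
      ∃ j j', N.label w w' = red j j' ∧ t w ≠ t w' ∧ j ≠ j' := by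
    intro w w' hne
    have hg : Consistent (green (t w)) (green (t w')) (N.label w w') := by
      have := N.consistent w w.2.1 x hx w' w'.2.1
      rwa [N.label_conv x hx w w.2.1, ht, ht] at this
    have hy' : Consistent yellow yellow (N.label w w') := by
      have := N.consistent w w.2.1 y hy w' w'.2.1
      rwa [N.label_conv y hy w w.2.1, w.2.2.2, w'.2.2.2] at this
    rcases eq_ident_or_red hg hy' with ⟨h, -⟩ | h
    · exact (hne (Subtype.ext ((N.label_eq_ident w w.2.1 w' w'.2.1).1 h))).elim
    · exact h
  have htinj : Function.Injective t := by
    intro w w' h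
    by_contra hne
    obtain ⟨_, _, -, h', -⟩ := hred w w' hne
    exact h' h
  obtain ⟨ρ, hρ, hρ'⟩ := exists_red_indexing (fun w w' : N.cone x y => N.label w w')
    (fun w w' => N.label_conv w w.2.1 w' w'.2.1)
    (fun w₁ w₂ w₃ => N.consistent w₁ w₁.2.1 w₂ w₂.2.1 w₃ w₃.2.1)
    (fun w w' hne => (hred w w' hne).imp fun _ => .imp fun _ h => ⟨h.1, h.2.2⟩)
  obtain ⟨k, hk⟩ : ∃ k, ∀ w, ρ w ≠ k := by
    -- If all red indices occurred, then |Q| ≤ |cone| ≤ |P| ≤ |Q|, so the injection `t` would be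
    -- bijective and `i` would occur in the cone.
    by_contra! hsurj
    have hsurj : Function.Surjective ρ := hsurj
    have hW : Finite (N.cone x y) := Finite.of_injective t htinj
    have hb : Function.Bijective t :=
      htinj.bijective_of_nat_card_le (hPQ.trans (Nat.card_le_card_of_surjective ρ hsurj))
    obtain ⟨w, hw⟩ := hb.2 i
    exact hi w w.2 (hw ▸ ht w)
  refine ⟨fun w => if h : w ∈ N.cone x y then ρ ⟨w, h⟩ else k, k, ?_, ?_⟩
  · intro w hw
    simpa [hw] using (hk ⟨w, hw⟩).symm
  · intro w hw w' hw' hne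
    simpa [hw, hw'] using hρ' ⟨w, hw⟩ ⟨w', hw'⟩ (by simpa using hne)

/-- The labels `ν` can be given to the edges from a new vertex that is joined to `x` and `y` by
`p` and `q`. -/
def Admissible (x y : ℕ) (p q : Atom P Q) (ν : ℕ → Atom P Q) : Prop :=
  (∀ w, ν w ≠ Atom.ident) ∧
  (∀ w ∈ N.verts, w ≠ x → w ≠ y → Consistent p (N.label x w) (ν w)) ∧
  (∀ w ∈ N.verts, w ≠ x → w ≠ y → Consistent q (N.label y w) (ν w)) ∧
  ∀ w ∈ N.verts, ∀ w' ∈ N.verts, Consistent (ν w) (N.label w w') (ν w')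

variable {N} in
theorem Admissible.symm {x y : ℕ} {p q : Atom P Q} {ν : ℕ → Atom P Q}
    (h : N.Admissible x y p q ν) : N.Admissible y x q p ν :=
  ⟨h.1, fun w hw hy hx => h.2.2.1 w hw hx hy, fun w hw hy hx => h.2.1 w hw hx hy, h.2.2.2⟩

/-- The only case that needs |P| ≤ |Q|: the new vertex belongs to the cone over `x` and `y`, and
receives the free red index `k`. -/
theorem exists_admissible_green_yellow [Finite P] [Finite Q] (hPQ : Nat.card P ≤ Nat.card Q)
    {x y : ℕ} (hx : x ∈ N.verts) (hy : y ∈ N.verts) {i : P}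
    (hi : ∀ w ∈ N.verts, N.label x w = green i → N.label y w ≠ yellow) :
    ∃ ν, N.Admissible x y (green i) yellow ν := by
  classical
  obtain ⟨ρ, k, hk, hρ⟩ := N.exists_cone_indexing hPQ hx hy (i := i)
    fun w hw h => hi w hw.1 h hw.2.2
  -- White is safe without a second green, black without a second yellow; only cone vertices have
  -- both.
  let ν : ℕ → Atom P Q := fun w =>
    if (N.label x w).IsGreen then if N.label y w = yellow then red k (ρ w) else black else white
  have hν : ∀ w ∈ N.verts, (ν w = white ∧ ¬ (N.label x w).IsGreen) ∨
      (ν w = black ∧ N.label y w ≠ yellow) ∨ (ν w = red k (ρ w) ∧ w ∈ N.cone x y) := by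
    intro w hw
    by_cases hg : (N.label x w).IsGreen
    · by_cases hy : N.label y w = yellow
      · exact .inr (.inr ⟨by simp [ν, hg, hy], hw, hg, hy⟩)
      · exact .inr (.inl ⟨by simp [ν, hg, hy], hy⟩)
    · exact .inl ⟨by simp [ν, hg], hg⟩
  have hne : ∀ w, ν w ≠ Atom.ident ∧ ¬ (ν w).IsGreen ∧ ν w ≠ yellow := by
    intro w
    dsimp only [ν]
    split_ifs <;> simp [IsGreen]
  refine ⟨ν, fun w => (hne w).1, ?_, ?_, ?_⟩
  · intro w hw hwx hwy
    have hl : N.label x w ≠ Atom.ident := fun h => hwx ((N.label_eq_ident x hx w hw).1 h).symm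
    rcases hν w hw with ⟨h, h'⟩ | ⟨h, h'⟩ | ⟨h, h'⟩ <;> rw [h]
    · exact consistent_white (by simp) hl fun h => h' h.2
    · exact consistent_black (by simp) hl (by simp)
    · obtain ⟨i', hi'⟩ := h'.2.1
      rw [hi', consistent_green_green_red]
      refine ⟨?_, hk w h'⟩
      rintro rfl
      exact hi w hw hi' h'.2.2
  · intro w hw hwx hwy
    have hl : N.label y w ≠ Atom.ident := fun h => hwy ((N.label_eq_ident y hy w hw).1 h).symm
    rcases hν w hw with ⟨h, h'⟩ | ⟨h, h'⟩ | ⟨h, h'⟩ <;> rw [h]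
    · exact consistent_white (by simp) hl (by simp [IsGreen])
    · exact consistent_black (by simp) hl fun h => h' h.2
    · rw [h'.2.2]
      exact consistent_yellow_yellow_red _ _
  · intro w hw w' hw'
    rcases eq_or_ne w w' with rfl | hww
    · simp [N.label_self hw]
    -- As `ν` is never green or yellow, nothing obstructs a white or black side.
    have hwhite : ∀ v ∈ N.verts, ∀ v' ∈ N.verts, v ≠ v' → ν v' = white ∨ ν v' = black →
        Consistent (ν v) (N.label v v') (ν v') := by
      intro v hv v' hv' hne' h
      have hl : N.label v v' ≠ Atom.ident := fun h => hne' ((N.label_eq_ident v hv v' hv').1 h)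
      rcases h with h | h <;> rw [h]
      · exact consistent_white (hne v).1 hl fun h => (hne v).2.1 h.1
      · exact consistent_black (hne v).1 hl fun h => (hne v).2.2 h.1
    rcases hν w' hw' with h' | h' | h'
    · exact hwhite w hw w' hw' hww (.inl h'.1)
    · exact hwhite w hw w' hw' hww (.inr h'.1)
    rcases hν w hw with h | h | h
    · exact N.consistent_symm hw' hw (hwhite w' hw' w hw hww.symm (.inl h.1))
    · exact N.consistent_symm hw' hw (hwhite w' hw' w hw hww.symm (.inr h.1))
    rw [h.1, h'.1, hρ w h.2 w' h'.2 hww, consistent_red_red_red]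
    exact ⟨rfl, rfl, rfl⟩

/-- Without green the constant label white works, without yellow the constant label black; one green
and one yellow remain. -/
theorem exists_admissible [Finite P] [Finite Q] (hPQ : Nat.card P ≤ Nat.card Q)
    {x y : ℕ} (hx : x ∈ N.verts) (hy : y ∈ N.verts) {p q : Atom P Q} (hp : p ≠ Atom.ident)
    (hq : q ≠ Atom.ident)
    (hpq : ∀ w ∈ N.verts, N.label x w = p.conv → N.label y w ≠ q.conv) :
    ∃ ν, N.Admissible x y p q ν := by
  have hlx : ∀ w ∈ N.verts, w ≠ x → N.label x w ≠ Atom.ident :=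
    fun w hw hne h => hne ((N.label_eq_ident x hx w hw).1 h).symm
  have hly : ∀ w ∈ N.verts, w ≠ y → N.label y w ≠ Atom.ident :=
    fun w hw hne h => hne ((N.label_eq_ident y hy w hw).1 h).symm
  by_cases hg : p.IsGreen ∨ q.IsGreen
  · by_cases hyel : p = yellow ∨ q = yellow
    · rcases hg with ⟨i, rfl⟩ | ⟨i, rfl⟩
      · obtain rfl := hyel.resolve_left (by simp)
        exact N.exists_admissible_green_yellow hPQ hx hy hpq
      · obtain rfl := hyel.resolve_right (by simp)
        obtain ⟨ν, hν⟩ := N.exists_admissible_green_yellow hPQ hy hx (i := i)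
          fun w hw h h' => hpq w hw h' h
        exact ⟨ν, hν.symm⟩
    · rw [not_or] at hyel
      exact ⟨fun _ => black, fun _ => by simp,
        fun w hw hwx _ => consistent_black hp (hlx w hw hwx) fun h => hyel.1 h.1,
        fun w hw _ hwy => consistent_black hq (hly w hw hwy) fun h => hyel.2 h.1,
        fun _ _ _ _ => consistent_black_black _⟩
  · rw [not_or] at hg
    exact ⟨fun _ => white, fun _ => by simp,
      fun w hw hwx _ => consistent_white hp (hlx w hw hwx) fun h => hg.1 h.1,
      fun w hw _ hwy => consistent_white hq (hly w hw hwy) fun h => hg.2 h.1,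
      fun _ _ _ _ => consistent_white_white _⟩

/-- Every requirement on a network can be met in an extension. -/
theorem exists_witness [Finite P] [Finite Q] (hPQ : Nat.card P ≤ Nat.card Q)
    {x y : ℕ} (hx : x ∈ N.verts) (hy : y ∈ N.verts) {a b : Atom P Q}
    (hab : Consistent a b (N.label x y)) :
    ∃ M, N ≤ M ∧ ∃ z ∈ M.verts, M.label x z = a ∧ M.label z y = b := by
  classical
  by_cases ha : a = Atom.ident
  · subst ha
    exact ⟨N, le_rfl, x, hx, N.label_self hx, (consistent_ident_left.1 hab).symm⟩
  by_cases hb : b = Atom.ident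
  · subst hb
    exact ⟨N, le_rfl, y, hy, (consistent_ident_mid.1 hab).symm, N.label_self hy⟩
  -- Reusing an existing witness guarantees that in the green-yellow case the green index is new in
  -- the cone.
  by_cases hwit : ∃ w ∈ N.verts, N.label x w = a ∧ N.label y w = b.conv
  · obtain ⟨w, hw, h, h'⟩ := hwit
    exact ⟨N, le_rfl, w, hw, h, by rw [N.label_conv y hy w hw, h', conv_conv]⟩
  push Not at hwit
  obtain ⟨ν, hν, hνx, hνy, hνν⟩ := N.exists_admissible hPQ hx hy (p := a.conv) (q := b)
    (by simpa using ha) hb (by simpa using hwit)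
  obtain ⟨z, hz⟩ := Infinite.exists_notMem_finset N.verts
  let μ : ℕ → Atom P Q := fun w => if w = x then a.conv else if w = y then b else ν w
  have hμx : μ x = a.conv := by simp [μ]
  have hμy : μ y = b := by
    -- For `x = y` both prescriptions concern the same edge, and they agree because the loop is
    -- labelled by the identity.
    by_cases hyx : y = x
    · subst hyx
      rw [N.label_self hy, consistent_ident_right] at hab
      simp [μ, hab]
    · simp [μ, hyx]
  have hμν : ∀ w, w ≠ x → w ≠ y → μ w = ν w := fun w h h' => by simp [μ, h, h']
  have hxy : Consistent (μ x) (N.label x y) (μ y) := by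
    rw [hμx, hμy]
    exact consistent_conv_left.2 hab
  have hxw : ∀ w ∈ N.verts, w ≠ x → w ≠ y → Consistent (μ x) (N.label x w) (μ w) := by
    intro w hw h h'
    rw [hμx, hμν w h h']
    exact hνx w hw h h'
  have hyw : ∀ w ∈ N.verts, w ≠ x → w ≠ y → Consistent (μ y) (N.label y w) (μ w) := by
    intro w hw h h'
    rw [hμy, hμν w h h']
    exact hνy w hw h h'
  suffices (∀ w ∈ N.verts, μ w ≠ Atom.ident) ∧
      ∀ w ∈ N.verts, ∀ w' ∈ N.verts, Consistent (μ w) (N.label w w') (μ w') by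
    obtain ⟨M, hNM, hzM, hM⟩ := N.exists_extension hz μ this.1 this.2
    exact ⟨M, hNM, z, hzM, by rw [(hM x hx).2, hμx, conv_conv], by rw [(hM y hy).1, hμy]⟩
  constructor
  · intro w _
    by_cases h : w = x
    · rw [h, hμx]; simpa using ha
    by_cases h' : w = y
    · rw [h', hμy]; exact hb
    rw [hμν w h h']
    exact hν w
  · intro w hw w' hw'
    rcases eq_or_ne w w' with rfl | hne
    · simp [N.label_self hw]
    by_cases hwx : w = x
    · subst hwx
      by_cases hwy : w' = y
      · subst hwy; exact hxy
      · exact hxw w' hw' hne.symm hwy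
    by_cases hwx' : w' = x
    · subst hwx'
      apply N.consistent_symm hw' hw
      by_cases hwy : w = y
      · subst hwy; exact hxy
      · exact hxw w hw hne hwy
    by_cases hwy : w = y
    · subst hwy; exact hyw w' hw' hwx' hne.symm
    by_cases hwy' : w' = y
    · subst hwy'; exact N.consistent_symm hw' hw (hyw w hw hwx hne)
    rw [hμν w hwx hwy, hμν w' hwx' hwy']
    exact hνν w hw w' hw'

theorem exists_mem_verts (z : ℕ) : ∃ M, N ≤ M ∧ z ∈ M.verts := by
  by_cases hz : z ∈ N.verts
  · exact ⟨N, le_rfl, hz⟩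
  · obtain ⟨M, hM, hzM, -⟩ := N.exists_extension hz (fun _ => white) (by simp)
      fun _ _ _ _ => consistent_white_white _
    exact ⟨M, hM, hzM⟩

end Network
-- The limit of networks and the resulting representation.
variable {P Q : Type u}

namespace Network

/-- A complete labelling of the pairs of natural numbers in which all consistent requirements
have witnesses. -/
theorem exists_saturated_label [Finite P] [Finite Q] (hPQ : Nat.card P ≤ Nat.card Q) :
    ∃ l : ℕ → ℕ → Atom P Q, (∀ x y, l x y = Atom.ident ↔ x = y) ∧
      (∀ x y, l y x = (l x y).conv) ∧ (∀ x y z, Consistent (l x y) (l y z) (l x z)) ∧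
      ∀ x y a b, Consistent a b (l x y) → ∃ z, l x z = a ∧ l z y = b := by
  have : Encodable (Atom P Q) := Encodable.ofCountable _
  let 𝒟 : ℕ ⊕ ℕ × ℕ × Atom P Q × Atom P Q → Order.Cofinal (Network P Q) := fun r => match r with
    | .inl x => ⟨{M | x ∈ M.verts}, fun N =>
        let ⟨M, h, h'⟩ := N.exists_mem_verts x; ⟨M, h', h⟩⟩
    | .inr (x, y, a, b) => ⟨{M | x ∈ M.verts ∧ y ∈ M.verts ∧ (Consistent a b (M.label x y) →
        ∃ z ∈ M.verts, M.label x z = a ∧ M.label z y = b)}, fun N => by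
          obtain ⟨N₁, h₁, hx⟩ := N.exists_mem_verts x
          obtain ⟨N₂, h₂, hy⟩ := N₁.exists_mem_verts y
          have hx₂ := h₂.1 hx
          by_cases hab : Consistent a b (N₂.label x y)
          · obtain ⟨M, h₃, hM⟩ := N₂.exists_witness hPQ hx₂ hy hab
            exact ⟨M, ⟨h₃.1 hx₂, h₃.1 hy, fun _ => hM⟩, (h₁.trans h₂).trans h₃⟩
          · exact ⟨N₂, ⟨hx₂, hy, fun h => (hab h).elim⟩, h₁.trans h₂⟩⟩
  -- There are countably many requirements, each cofinal, so by the Rasiowa–Sikorski lemma some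
  -- ideal of networks meets them all.
  let I := Order.idealOfCofinals default 𝒟
  have hdir : ∀ N ∈ I, ∀ M ∈ I, ∃ K ∈ I, N ≤ K ∧ M ≤ K := I.directed
  have hverts : ∀ x, ∃ N ∈ I, x ∈ N.verts := fun x =>
    let ⟨N, h, h'⟩ := Order.cofinal_meets_idealOfCofinals default 𝒟 (.inl x)
    ⟨N, h', h⟩
  have hverts₂ : ∀ x y, ∃ N ∈ I, x ∈ N.verts ∧ y ∈ N.verts := by
    intro x y
    obtain ⟨N, hN, hx⟩ := hverts x
    obtain ⟨M, hM, hy⟩ := hverts y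
    obtain ⟨K, hK, h, h'⟩ := hdir N hN M hM
    exact ⟨K, hK, h.1 hx, h'.1 hy⟩
  have hverts₃ : ∀ x y z, ∃ N ∈ I, x ∈ N.verts ∧ y ∈ N.verts ∧ z ∈ N.verts := by
    intro x y z
    obtain ⟨N, hN, hx, hy⟩ := hverts₂ x y
    obtain ⟨M, hM, hz⟩ := hverts z
    obtain ⟨K, hK, h, h'⟩ := hdir N hN M hM
    exact ⟨K, hK, h.1 hx, h.1 hy, h'.1 hz⟩
  -- The limit label of `(x, y)` is read in any network of the ideal containing both; directedness
  -- makes the choice irrelevant.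
  choose F hF hFx hFy using hverts₂
  have hlabel : ∀ N ∈ I, ∀ x ∈ N.verts, ∀ y ∈ N.verts, (F x y).label x y = N.label x y := by
    intro N hN x hx y hy
    obtain ⟨K, -, h, h'⟩ := hdir N hN (F x y) (hF x y)
    rw [← h.2 x hx y hy, ← h'.2 x (hFx x y) y (hFy x y)]
  refine ⟨fun x y => (F x y).label x y, fun x y => ?_, fun x y => ?_, fun x y z => ?_,
    fun x y a b hab => ?_⟩
  · exact (F x y).label_eq_ident x (hFx x y) y (hFy x y)
  · dsimp only
    rw [hlabel (F x y) (hF x y) y (hFy x y) x (hFx x y)]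
    exact (F x y).label_conv x (hFx x y) y (hFy x y)
  · obtain ⟨N, hN, hx, hy, hz⟩ := hverts₃ x y z
    dsimp only
    rw [hlabel N hN x hx y hy, hlabel N hN y hy z hz, hlabel N hN x hx z hz]
    exact N.consistent x hx y hy z hz
  · obtain ⟨N, ⟨hx, hy, h⟩, hN⟩ :=
      Order.cofinal_meets_idealOfCofinals default 𝒟 (.inr (x, y, a, b))
    dsimp only at hab
    rw [hlabel N hN x hx y hy] at hab
    obtain ⟨z, hz, h₁, h₂⟩ := h hab
    exact ⟨z, (hlabel N hN x hx z hz).trans h₁, (hlabel N hN z hz y hy).trans h₂⟩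

end Network

namespace Rainbow

/-- The representation given by a saturated labelling. -/
def embeddingOfLabel {X : Type u} (l : X → X → Atom P Q)
    (hident : ∀ x y, l x y = Atom.ident ↔ x = y) (hconv : ∀ x y, l y x = (l x y).conv)
    (htri : ∀ x y z, Consistent (l x y) (l y z) (l x z))
    (hwit : ∀ x y a b, Consistent a b (l x y) → ∃ z, l x z = a ∧ l z y = b)
    (hsurj : ∀ a, ∃ x y, l x y = a) :
    Rainbow P Q ↪[lang] ProperAlgebra (⊤ : Setoid X) where
  toFun V := ⟨{p | l p.1 p.2 ∈ atoms V}, fun _ _ => trivial⟩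
  inj' V W h := by
    ext a
    obtain ⟨x, y, rfl⟩ := hsurj a
    exact Set.ext_iff.1 (congrArg Subtype.val h) (x, y)
  map_fun' f v := by
    apply Subtype.ext
    ext ⟨x, y⟩
    cases f with
    | zero => exact Iff.rfl
    | one => exact Iff.rfl
    | ident => exact hident x y
    | neg => exact (and_iff_right trivial).symm
    | conv =>
      refine (mem_atoms_conv (X := v 0)).trans ?_
      rw [← hconv]
      exact Iff.rfl
    | add => exact Iff.rfl
    | comp =>
      refine (mem_atoms_comp (X := v 0) (Y := v 1)).trans ?_
      constructor
      · rintro ⟨a, ha, b, hb, h⟩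
        obtain ⟨z, rfl, rfl⟩ := hwit x y a b h
        exact ⟨z, ha, hb⟩
      · rintro ⟨z, ha, hb⟩
        exact ⟨_, ha, _, hb, htri x z y⟩
  map_rel' r := r.elim

theorem isRRA_of_card_le [Finite P] [Finite Q] [Nontrivial Q] (hPQ : Nat.card P ≤ Nat.card Q) :
    IsRRA (Rainbow P Q) := by
  obtain ⟨l, hident, hconv, htri, hwit⟩ := Network.exists_saturated_label hPQ
  refine ⟨isRelationAlgebra, ULift ℕ, ⊤, ⟨embeddingOfLabel (fun x y => l x.down y.down)
    (fun x y => (hident _ _).trans ULift.down_inj) (fun x y => hconv _ _)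
    (fun x y z => htri _ _ _) (fun x y a b h => ?_) fun a => ?_⟩⟩
  · obtain ⟨z, hz⟩ := hwit _ _ a b h
    exact ⟨⟨z⟩, hz⟩
  · obtain ⟨z, hz, -⟩ := hwit 0 0 a a.conv (by
      rw [(hident 0 0).2 rfl, consistent_ident_right])
    exact ⟨⟨0⟩, ⟨z⟩, hz⟩

theorem card_le_of_isRRA [Finite P] [Finite Q] [Nonempty Q] (h : IsRRA (Rainbow P Q)) :
    Nat.card P ≤ Nat.card Q := by
  obtain ⟨-, X, E, ⟨e⟩⟩ := h
  obtain ⟨ρ, hρ⟩ := exists_injective_of_embedding e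
  exact Nat.card_le_card_of_injective ρ hρ

/-- The comparison of the rainbow algebras `B_{S,S}` and `B_{T,S}`. -/
theorem rainbow_properties (n : ℕ) (S T : Type u) (hS : Nat.card S = 2 ^ (n + 1))
    (hT : Nat.card T = 2 ^ (n + 1) + 1) :
      RelAlg.IsRelationAlgebra (RelAlg.Rainbow S S) ∧
      RelAlg.IsRelationAlgebra (RelAlg.Rainbow T S) ∧
      RelAlg.IsRRA (RelAlg.Rainbow S S) ∧
      ¬ RelAlg.IsRRA (RelAlg.Rainbow T S) ∧
      ∀ φ : RelAlg.lang.Sentence, RelAlg.quantifierDepth φ ≤ n →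
        (RelAlg.Rainbow S S ⊨ φ ↔ RelAlg.Rainbow T S ⊨ φ) := by
  have hpos : 1 < 2 ^ (n + 1) := Nat.one_lt_two_pow (by omega)
  have : Finite S := Nat.finite_of_card_ne_zero (by omega)
  have : Finite T := Nat.finite_of_card_ne_zero (by omega)
  have : Nontrivial S := (Finite.one_lt_card_iff_nontrivial).1 (hS ▸ hpos)
  refine ⟨Rainbow.isRelationAlgebra, Rainbow.isRelationAlgebra, Rainbow.isRRA_of_card_le le_rfl,
    fun h => ?_, fun φ hφ => Rainbow.models_iff (by omega) (by omega) φ hφ⟩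
  have := Rainbow.card_le_of_isRRA h
  omega

end Rainbow
end RelAlg

theorem theorem4p6 :
    (∀ Th : RelAlg.lang.Theory, RelAlg.DefinesRRA.{u} Th →
      ∀ n : ℕ, ∃ φ ∈ Th, n ≤ RelAlg.quantifierDepth φ) ∧
    ∀ (n : ℕ) (S T : Type u), Nat.card S = 2 ^ (n + 1) → Nat.card T = 2 ^ (n + 1) + 1 →
      RelAlg.IsRelationAlgebra (RelAlg.Rainbow S S) ∧
      RelAlg.IsRelationAlgebra (RelAlg.Rainbow T S) ∧
      RelAlg.IsRRA (RelAlg.Rainbow S S) ∧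
      ¬ RelAlg.IsRRA (RelAlg.Rainbow T S) ∧
      ∀ φ : RelAlg.lang.Sentence, RelAlg.quantifierDepth φ ≤ n →
        (RelAlg.Rainbow S S ⊨ φ ↔ RelAlg.Rainbow T S ⊨ φ) := by
  refine ⟨fun Th hTh n => ?_, RelAlg.Rainbow.rainbow_properties⟩
  by_contra! hlt
  obtain ⟨hSS, hTS, hrep, hnrep, hiff⟩ := RelAlg.Rainbow.rainbow_properties n
    (ULift.{u} (Fin (2 ^ (n + 1)))) (ULift.{u} (Fin (2 ^ (n + 1) + 1))) (by simp) (by simp)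
  -- The representable algebra is a model of `Th`, and all sentences of `Th` have depth below `n`,
  -- so the other algebra is a model as well.
  refine hnrep ((hTh _ hTS).1 ⟨fun φ hφ => ?_⟩)
  exact (hiff φ (hlt φ hφ).le).1 (((hTh _ hSS).2 hrep).realize_of_mem φ hφ)
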